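/- **Definitions.** Let $n>k\ge r\ge 1$ be integers. An $(n,k,r)$-LRC is a linear code $C\subseteq\mathbb F^n$ of dimension $k$ over some finite field $\mathbb F$ such that for every coordinate $i\in\{1,\dots,n\}$ there are a set $S\not\ni i$ of at most $r$ coordinates and scalars $a_j\in\mathbb F$ $(j\in S)$ with $c_i=\sum_{j\in S}a_jc_j$ for all $c\in C$. The minimum distance of $C$ is the minimum Hamming distance between two distinct codewords. Let $\mathscr D(n,k,r)$ be the largest minimum distance of an $(n,k,r)$-LRC, over all finite fields, and put $d^*=n-k-\lceil k/r\rceil+2$, $$k_1=\left\lceil \tfrac{k}{r}\right\rceil,\quad k_2=k_1r-k,\quad n_1=\left\lceil \tfrac{n}{r+1}\right\rceil,\quad n_2=n_1(r+1)-n .$$ **Theorem.** Let $n>k\ge r\ge 1$ be integers for which at least one $(n,k,r)$-LRC exists, and suppose that $k_2<k_1-1$. Then $\mathscr D(n,k,r)=d^*$ if and only if $$n_2\le n_1-\left(\left\lceil\frac{n_1-k_1+1}{\left\lfloor\frac{k_1-1}{k_1-k_2-1}\right\rfloor}\right\rceil+k_1-k_2-1\right).$$ -/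

import Mathlib

/-- Every coordinate of the linear code `C` of length `n` is, on all codewords, one fixed linear
combination of at most `r` other coordinates (all-symbol locality `r`). -/
def HasLocality {F : Type} [Field F] {n : ℕ} (C : Submodule F (Fin n → F)) (r : ℕ) : Prop :=
  ∀ i : Fin n, ∃ S : Finset (Fin n), i ∉ S ∧ S.card ≤ r ∧
    ∃ a : Fin n → F, ∀ c ∈ C, c i = ∑ j ∈ S, a j * c j

/-- An `(n, k, r)`-LRC: a linear code of length `n` and dimension `k` with locality `r`. -/
def IsLRC {F : Type} [Field F] {n : ℕ} (C : Submodule F (Fin n → F)) (k r : ℕ) : Prop :=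
  Module.finrank F C = k ∧ HasLocality C r

open Classical in
/-- `d` is the minimum distance of `C`: the minimum of the Hamming distances between two distinct
codewords. -/
def IsMinDist {F : Type} [Field F] {n : ℕ} (C : Submodule F (Fin n → F)) (d : ℕ) : Prop :=
  IsLeast {m : ℕ | ∃ x ∈ C, ∃ y ∈ C, x ≠ y ∧ hammingDist x y = m} d

/-- The minimum distances of all `(n, k, r)`-LRCs, over all finite fields. -/
def lrcMinDists (n k r : ℕ) : Set ℕ :=
  {d : ℕ | ∃ (F : Type) (_ : Field F) (_ : Finite F) (C : Submodule F (Fin n → F)),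
    IsLRC C k r ∧ IsMinDist C d}

/-- The largest possible minimum distance of an `(n, k, r)`-LRC. -/
noncomputable def largestMinDist (n k r : ℕ) : ℕ := sSup (lrcMinDists n k r)

theorem lrcMinDists_bddAbove (n k r : ℕ) : BddAbove (lrcMinDists n k r) := by
  refine ⟨n, ?_⟩
  classical
  rintro d ⟨F, _, _, C, -, ⟨x, -, y, -, -, rfl⟩, -⟩
  exact hammingDist_le_card_fintype.trans_eq (Fintype.card_fin n)

/-- As soon as some `(n, k, r)`-LRC has a minimum distance, the supremum is a maximum. -/
theorem largestMinDist_isGreatest {n k r : ℕ} (h : (lrcMinDists n k r).Nonempty) :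
    IsGreatest (lrcMinDists n k r) (largestMinDist n k r) :=
  ⟨Nat.sSup_mem h (lrcMinDists_bddAbove n k r),
    fun _ hd => le_csSup (lrcMinDists_bddAbove n k r) hd⟩

/-- The Singleton-type bound `d* = n - k - ⌈k / r⌉ + 2`. -/
def dStar (n k r : ℕ) : ℤ := (n : ℤ) - k - ⌈(k : ℚ) / r⌉ + 2

/-- `k₁ = ⌈k / r⌉`. -/
def kOne (k r : ℕ) : ℤ := ⌈(k : ℚ) / r⌉

/-- `k₂ = k₁ r - k`. -/
def kTwo (k r : ℕ) : ℤ := kOne k r * r - k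

/-- `n₁ = ⌈n / (r + 1)⌉`. -/
def nOne (n r : ℕ) : ℤ := ⌈(n : ℚ) / (r + 1)⌉

/-- `n₂ = n₁ (r + 1) - n`. -/
def nTwo (n r : ℕ) : ℤ := nOne n r * (r + 1) - n

/-!
Write `K = ⌈k / r⌉`, `N = ⌈n / (r + 1)⌉`, `c = k₁ - k₂ - 1` and `q = ⌊(k₁ - 1) / c⌋`, so that
`k + K = K r + c + 1` and `n = N r + (n₁ - n₂)`. The criterion then reads
`N r + c + 1 + ⌊(N - K) / q⌋ ≤ n`.

Locality means that every coordinate lies in the support of a parity check with at most `r + 1`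
nonzero entries. Choose a minimal family of such checks whose supports cover all coordinates; each
of them has a coordinate of its own. A nonzero codeword vanishing on a set `U` that contains the
supports of `s` of these checks exists as soon as `|U| < k + s`, because each check saves one
condition (`exists_mem_ne_zero_of_card_lt_finrank_add`). With `s = K - 1` this gives the
Singleton-type bound (`singleton_bound`), and with `s = K` it shows that in a code attaining the
bound any `K` checks of the family involve at least `k + K` coordinates.

The necessity of the criterion is therefore a statement about finite sets of size at most `r + 1`
(`exists_subset_card_eq_unionExcess_le`): if every `K` members of a family of at least `K` sets
cover more than `K r + c` points, then `m` members cover more than `m r + c + ⌊(m - K) / q⌋`. Let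
the excess of a family be the size of its union minus `r` times the number of its members. It is
additive over the components of the family (with respect to intersecting members), and it is at
most `1` on every family that can be built up by successively adding sets meeting the previous
ones. If fewer than `c` components have excess `1`, fill up `K` members component by component; if
all components of excess `1` are larger than `q`, then `c` of them contain `K` members; in both
cases the excess is at most `c`. Otherwise remove a component of excess `1` with at most `q`
members and use induction.

For sufficiency, let `p = n₁ - n₂`, distribute `N` checks as evenly as possible over `p` classes,
and let each check consist of `r` private coordinates and one coordinate common to its class. The
criterion makes any `K` checks meet more than `c` classes (`lt_card_image_mod`), which bounds the
dimension of the space of solutions supported on a given set of `n - k - K + 1` coordinates. Over a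
large finite field, a `k`-dimensional space of solutions in general position contains none of
these solutions except `0` (`exists_submodule_le_ker_localMap`), and so attains the bound.
-/

/-! ### Unions of finite sets: splitting off components -/

section Excess

variable {ι α : Type*} [DecidableEq α]

/-- The number of points covered by the subfamily `J` of `R`, in excess of `r` points per member. -/
def unionExcess (R : ι → Finset α) (r : ℕ) (J : Finset ι) : ℤ :=
  (J.biUnion R).card - r * J.card

variable {R : ι → Finset α} {r : ℕ}

@[simp]
theorem unionExcess_empty : unionExcess R r ∅ = 0 := by simp [unionExcess]

theorem unionExcess_singleton_le (hR : ∀ i, (R i).card ≤ r + 1) (i : ι) :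
    unionExcess R r {i} ≤ 1 := by
  have := hR i
  simp only [unionExcess, Finset.singleton_biUnion, Finset.card_singleton]
  push_cast
  omega

/-- A family is tame if it has subfamilies of every possible size with excess at most `1`. When
the members of the family have at most `r + 1` points, this holds as soon as they can be listed so
that each of them meets the union of the preceding ones. -/
def IsTame (R : ι → Finset α) (r : ℕ) (B : Finset ι) : Prop :=
  ∀ j ≤ B.card, ∃ J ⊆ B, J.card = j ∧ unionExcess R r J ≤ 1

theorem IsTame.unionExcess_le_one {B : Finset ι} (hB : IsTame R r B) : unionExcess R r B ≤ 1 := by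
  obtain ⟨J, hJ, hc, hf⟩ := hB _ le_rfl
  rwa [Finset.eq_of_subset_of_card_le hJ hc.ge] at hf

theorem isTame_singleton (hR : ∀ i, (R i).card ≤ r + 1) (i : ι) : IsTame R r {i} := by
  intro j hj
  rw [Finset.card_singleton] at hj
  rcases Nat.le_one_iff_eq_zero_or_eq_one.1 hj with rfl | rfl
  · exact ⟨∅, by simp, by simp, by simp⟩
  · exact ⟨{i}, subset_rfl, by simp, unionExcess_singleton_le hR i⟩

variable [DecidableEq ι]

theorem unionExcess_union_add_card_inter_le {A B : Finset ι} (h : Disjoint A B) :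
    unionExcess R r (A ∪ B) + (A.biUnion R ∩ B.biUnion R).card
      = unionExcess R r A + unionExcess R r B := by
  have h1 := Finset.card_union_add_card_inter (A.biUnion R) (B.biUnion R)
  rw [← Finset.union_biUnion] at h1
  unfold unionExcess
  rw [Finset.card_union_of_disjoint h]
  push_cast
  have h2 : ((A ∪ B).biUnion R).card + ((A.biUnion R ∩ B.biUnion R).card : ℤ)
      = (A.biUnion R).card + ((B.biUnion R).card : ℤ) := by exact_mod_cast h1
  linarith

theorem unionExcess_union_le {A B : Finset ι} (h : Disjoint A B) :
    unionExcess R r (A ∪ B) ≤ unionExcess R r A + unionExcess R r B := by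
  rw [← unionExcess_union_add_card_inter_le h]
  simp

theorem unionExcess_union_of_disjoint {A B : Finset ι} (h : Disjoint A B)
    (hR : Disjoint (A.biUnion R) (B.biUnion R)) :
    unionExcess R r (A ∪ B) = unionExcess R r A + unionExcess R r B := by
  rw [← unionExcess_union_add_card_inter_le h, Finset.disjoint_iff_inter_eq_empty.1 hR]
  simp

theorem IsTame.insert (hR : ∀ i, (R i).card ≤ r + 1) {B : Finset ι} (hB : IsTame R r B) {x : ι}
    (hx : x ∉ B) (hmeet : ¬ Disjoint (R x) (B.biUnion R)) : IsTame R r (insert x B) := by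
  intro j hj
  rw [Finset.card_insert_of_notMem hx] at hj
  rcases Nat.lt_or_ge B.card j with hlt | hle
  · obtain rfl : j = B.card + 1 := by omega
    refine ⟨_, subset_rfl, Finset.card_insert_of_notMem hx, ?_⟩
    have h1 := unionExcess_union_add_card_inter_le (R := R) (r := r)
      (Finset.disjoint_singleton_left.2 hx)
    rw [Finset.singleton_biUnion] at h1
    have h2 : 0 < (R x ∩ B.biUnion R).card := by
      rw [Finset.card_pos, Finset.nonempty_iff_ne_empty]
      rwa [Finset.disjoint_iff_inter_eq_empty] at hmeet
    have h3 := unionExcess_singleton_le hR x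
    have h4 := hB.unionExcess_le_one
    rw [Finset.insert_eq]
    omega
  · obtain ⟨J, hJ, hc, hf⟩ := hB j hle
    exact ⟨J, hJ.trans (Finset.subset_insert _ _), hc, hf⟩

/-- A nonempty family contains a nonempty tame subfamily whose union is disjoint from the union of
all other members: a maximal tame subfamily will do. -/
theorem exists_isTame_component (hR : ∀ i, (R i).card ≤ r + 1) {I : Finset ι}
    (hI : I.Nonempty) :
    ∃ B ⊆ I, B.Nonempty ∧ IsTame R r B ∧ Disjoint (B.biUnion R) ((I \ B).biUnion R) := by
  classical
  obtain ⟨i, hi⟩ := hI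
  obtain ⟨B, hB, hmax⟩ := Finset.exists_max_image
    (I.powerset.filter fun B => B.Nonempty ∧ IsTame R r B) Finset.card
    ⟨{i}, by simp [hi, isTame_singleton hR]⟩
  simp only [Finset.mem_filter, Finset.mem_powerset] at hB hmax
  refine ⟨B, hB.1, hB.2.1, hB.2.2, ?_⟩
  rw [Finset.disjoint_biUnion_right]
  intro x hx
  rw [Finset.mem_sdiff] at hx
  by_contra hd
  have := hmax (insert x B) ⟨Finset.insert_subset hx.1 hB.1, Finset.insert_nonempty _ _,
    hB.2.2.insert hR hx.2 fun h => hd h.symm⟩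
  rw [Finset.card_insert_of_notMem hx.2] at this
  omega

/-- A finite family of sets of size at most `r + 1` splits into tame subfamilies, each of which
has a union disjoint from all members outside it. -/
theorem exists_isTame_partition (hR : ∀ i, (R i).card ≤ r + 1) (I : Finset ι) :
    ∃ P : Finset (Finset ι), (P : Set (Finset ι)).PairwiseDisjoint id ∧ P.biUnion id = I ∧
      ∀ B ∈ P, B.Nonempty ∧ IsTame R r B ∧ Disjoint (B.biUnion R) ((I \ B).biUnion R) := by
  induction I using Finset.strongInduction with
  | H I ih =>
    rcases I.eq_empty_or_nonempty with rfl | hI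
    · exact ⟨∅, by simp, by simp, by simp⟩
    obtain ⟨B, hBI, hB, hBt, hBd⟩ := exists_isTame_component hR hI
    obtain ⟨P, hP, hPI, hPB⟩ := ih (I \ B) (Finset.sdiff_ssubset hBI hB)
    have hsub : ∀ B' ∈ P, B' ⊆ I \ B := fun B' h => by
      rw [← hPI]; exact Finset.subset_biUnion_of_mem id h
    refine ⟨insert B P, ?_, ?_, ?_⟩
    · rw [Finset.coe_insert]
      refine hP.insert fun B' h _ => ?_
      exact Finset.disjoint_of_subset_right (hsub B' h) Finset.disjoint_sdiff
    · rw [Finset.biUnion_insert, hPI, id, Finset.union_sdiff_of_subset hBI]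
    · intro B' h
      rcases Finset.mem_insert.1 h with rfl | h
      · exact ⟨hB, hBt, hBd⟩
      obtain ⟨h1, h2, h3⟩ := hPB B' h
      refine ⟨h1, h2, ?_⟩
      have h4 : I \ B' ⊆ ((I \ B) \ B') ∪ B := by
        intro x hx
        simp only [Finset.mem_union, Finset.mem_sdiff] at hx ⊢
        tauto
      refine Finset.disjoint_of_subset_right (Finset.biUnion_subset_biUnion_of_subset_left R h4) ?_
      rw [Finset.union_biUnion, Finset.disjoint_union_right]
      exact ⟨h3, (Finset.disjoint_of_subset_right
        (Finset.biUnion_subset_biUnion_of_subset_left R (hsub B' h)) hBd).symm⟩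

theorem exists_subset_unionExcess_le_card {P : Finset (Finset ι)}
    (hP : (P : Set (Finset ι)).PairwiseDisjoint id) (ht : ∀ B ∈ P, IsTame R r B) :
    ∀ s ≤ (P.biUnion id).card, ∃ J ⊆ P.biUnion id, J.card = s ∧ unionExcess R r J ≤ P.card := by
  induction P using Finset.induction_on with
  | empty => intro s hs; exact ⟨∅, by simp, by simp at hs; simp [hs], by simp⟩
  | insert B P hB ih =>
    intro s hs
    rw [Finset.coe_insert] at hP
    have hd : Disjoint (P.biUnion id) B := by
      rw [Finset.disjoint_biUnion_left]
      intro B' h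
      exact hP (Set.mem_insert_of_mem _ h) (Set.mem_insert _ _) (by rintro rfl; exact hB h)
    have ih := ih (hP.subset (Set.subset_insert _ _))
      fun B' h => ht B' (Finset.mem_insert_of_mem h)
    rw [Finset.biUnion_insert, Finset.union_comm, id] at hs ⊢
    rw [Finset.card_union_of_disjoint hd] at hs
    rw [Finset.card_insert_of_notMem hB]
    obtain ⟨J, hJ, hJc, hJf⟩ := ih (min s (P.biUnion id).card) (min_le_right _ _)
    obtain ⟨J', hJ', hJc', hJf'⟩ := ht B (Finset.mem_insert_self _ _)
      (s - min s (P.biUnion id).card) (by omega)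
    have hdd : Disjoint J J' := Finset.disjoint_of_subset_left hJ
      (Finset.disjoint_of_subset_right hJ' hd)
    refine ⟨J ∪ J', Finset.union_subset_union hJ hJ', ?_, ?_⟩
    · rw [Finset.card_union_of_disjoint hdd]; omega
    · have := unionExcess_union_le (R := R) (r := r) hdd
      push_cast
      linarith

/-- Whole components without positive excess are free of charge, and a component that is used in
part costs at most `1`. -/
theorem exists_subset_unionExcess_le_card_filter {P : Finset (Finset ι)}
    (hP : (P : Set (Finset ι)).PairwiseDisjoint id) (ht : ∀ B ∈ P, IsTame R r B) :
    unionExcess R r (P.biUnion id) ≤ (P.filter fun B => unionExcess R r B = 1).card ∧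
    ∀ s ≤ (P.biUnion id).card, ∃ J ⊆ P.biUnion id, J.card = s ∧
      unionExcess R r J ≤ (P.filter fun B => unionExcess R r B = 1).card + 1 := by
  induction P using Finset.induction_on with
  | empty => exact ⟨by simp, fun s hs => ⟨∅, by simp, by simp at hs; simp [hs], by simp⟩⟩
  | insert B P hB ih =>
    rw [Finset.coe_insert] at hP
    have hd : Disjoint (P.biUnion id) B := by
      rw [Finset.disjoint_biUnion_left]
      intro B' h
      exact hP (Set.mem_insert_of_mem _ h) (Set.mem_insert _ _) (by rintro rfl; exact hB h)
    obtain ⟨ih1, ih2⟩ := ih (hP.subset (Set.subset_insert _ _))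
      fun B' h => ht B' (Finset.mem_insert_of_mem h)
    rw [Finset.biUnion_insert, Finset.union_comm, id, Finset.card_union_of_disjoint hd]
    have hmono : ((P.filter fun B => unionExcess R r B = 1).card : ℤ) ≤
        ((insert B P).filter fun B => unionExcess R r B = 1).card := by
      exact_mod_cast Finset.card_le_card
        (Finset.filter_subset_filter _ (Finset.subset_insert _ _))
    refine ⟨?_, fun s hs => ?_⟩
    · have h1 := unionExcess_union_le (R := R) (r := r) hd
      have h2 := (ht B (Finset.mem_insert_self _ _)).unionExcess_le_one
      by_cases h3 : unionExcess R r B = 1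
      · rw [Finset.filter_insert, if_pos h3, Finset.card_insert_of_notMem
          (fun h => hB (Finset.mem_of_mem_filter _ h))]
        push_cast
        linarith
      · have : unionExcess R r B ≤ 0 := by omega
        linarith
    · rcases Nat.lt_or_ge (P.biUnion id).card s with hlt | hle
      · obtain ⟨J', hJ', hJc', hJf'⟩ := ht B (Finset.mem_insert_self _ _)
          (s - (P.biUnion id).card) (by omega)
        have hdd := Finset.disjoint_of_subset_right hJ' hd
        refine ⟨P.biUnion id ∪ J', Finset.union_subset_union subset_rfl hJ', ?_, ?_⟩
        · rw [Finset.card_union_of_disjoint hdd]; omega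
        · have := unionExcess_union_le (R := R) (r := r) hdd
          linarith
      · obtain ⟨J, hJ, hJc, hJf⟩ := ih2 s hle
        exact ⟨J, hJ.trans Finset.subset_union_left, hJc, by linarith⟩

/-- A family whose union is small contains a subfamily of the prescribed size `s` whose union is
small. As long as there are `c` components of excess `1`, either `c` of them together have at least
`s` members, or a component with at most `q` members can be removed, which lowers the excess
by `1`. -/
theorem exists_subset_card_eq_unionExcess_le (hR : ∀ i, (R i).card ≤ r + 1) {s c q : ℕ}
    (hsq : s ≤ c * (q + 1)) (I : Finset ι) (hs : s ≤ I.card)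
    (hI : unionExcess R r I ≤ c + ((I.card - s) / q : ℕ)) :
    ∃ J ⊆ I, J.card = s ∧ unionExcess R r J ≤ c := by
  induction I using Finset.strongInduction with
  | H I ih =>
    obtain ⟨P, hP, rfl, hPB⟩ := exists_isTame_partition hR I
    set I := P.biUnion id with hIdef
    have ht : ∀ B ∈ P, IsTame R r B := fun B h => (hPB B h).2.1
    rcases Nat.lt_or_ge (P.filter fun B => unionExcess R r B = 1).card c with hlt | hge
    · obtain ⟨J, hJ, hJc, hJf⟩ := (exists_subset_unionExcess_le_card_filter hP ht).2 s hs
      exact ⟨J, hJ, hJc, by omega⟩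
    by_cases hbig : ∀ B ∈ P, unionExcess R r B = 1 → q + 1 ≤ B.card
    · obtain ⟨Q, hQ, hQc⟩ := Finset.exists_subset_card_eq hge
      have hQP : Q ⊆ P := hQ.trans (Finset.filter_subset _ _)
      have hQd : (Q : Set (Finset ι)).PairwiseDisjoint id := hP.subset (by exact_mod_cast hQP)
      have hcard : s ≤ (Q.biUnion id).card := by
        rw [Finset.card_biUnion hQd]
        refine hsq.trans ?_
        rw [← hQc, ← smul_eq_mul]
        refine Finset.card_nsmul_le_sum _ _ _ fun B h => ?_
        have := Finset.mem_filter.1 (hQ h)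
        exact hbig B this.1 this.2
      obtain ⟨J, hJ, hJc, hJf⟩ := exists_subset_unionExcess_le_card hQd
        (fun B h => ht B (hQP h)) s hcard
      exact ⟨J, hJ.trans (Finset.biUnion_subset_biUnion_of_subset_left _ hQP), hJc,
        by rwa [hQc] at hJf⟩
    push Not at hbig
    obtain ⟨B, hBP, hB1, hBq⟩ := hbig
    obtain ⟨hBne, hBt, hBd⟩ := hPB B hBP
    have hBI : B ⊆ I := Finset.subset_biUnion_of_mem id hBP
    have hsplit : unionExcess R r I = unionExcess R r B + unionExcess R r (I \ B) := by
      rw [← unionExcess_union_of_disjoint Finset.disjoint_sdiff hBd,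
        Finset.union_sdiff_of_subset hBI]
    have hcard : (I \ B).card = I.card - B.card := Finset.card_sdiff_of_subset hBI
    have hBle : B.card ≤ I.card := Finset.card_le_card hBI
    rcases Nat.lt_or_ge (I \ B).card s with hlt | hle
    · -- Removing all of `B` would leave fewer than `s` members, so part of `B` is kept.
      have h0 : (I.card - s) / q = 0 := Nat.div_eq_of_lt (by omega)
      obtain ⟨J, hJ, hJc, hJf⟩ := hBt (s - (I \ B).card) (by omega)
      have hdd : Disjoint (I \ B) J :=
        Finset.disjoint_of_subset_right hJ Finset.sdiff_disjoint
      refine ⟨(I \ B) ∪ J, Finset.union_subset Finset.sdiff_subset (hJ.trans hBI), ?_, ?_⟩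
      · rw [Finset.card_union_of_disjoint hdd]; omega
      · have := unionExcess_union_le (R := R) (r := r) hdd
        rw [h0] at hI
        push_cast at hI
        linarith
    · have hqpos : 0 < q := by have := hBne.card_pos; omega
      have hdiv : (I.card - s) / q ≤ ((I \ B).card - s) / q + 1 := by
        rw [← Nat.add_div_right _ hqpos]
        exact Nat.div_le_div_right (by omega)
      obtain ⟨J, hJ, hJc, hJf⟩ := ih (I \ B) (Finset.sdiff_ssubset hBI hBne) hle (by omega)
      exact ⟨J, hJ.trans Finset.sdiff_subset, hJc, hJf⟩

end Excess

/-! ### Locality and minimum distance -/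

section Codes

variable {F : Type} [Field F] {n k r : ℕ} {C : Submodule F (Fin n → F)}

/-- `h` is a parity check of `C` with at most `w` nonzero entries. -/
def IsSparseCheck (C : Submodule F (Fin n → F)) (w : ℕ) (h : Fin n → F) : Prop :=
  (∃ S : Finset (Fin n), S.card ≤ w ∧ ∀ j ∉ S, h j = 0) ∧ ∀ c ∈ C, ∑ j, h j * c j = 0

theorem hasLocality_iff_exists_isSparseCheck :
    HasLocality C r ↔ ∀ i, ∃ h, IsSparseCheck C (r + 1) h ∧ h i ≠ 0 := by
  classical
  constructor
  · intro hC i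
    obtain ⟨S, hiS, hS, a, ha⟩ := hC i
    refine ⟨fun j => if j = i then 1 else if j ∈ S then -a j else 0,
      ⟨⟨insert i S, by rw [Finset.card_insert_of_notMem hiS]; omega, ?_⟩, ?_⟩, by simp⟩
    · intro j hj
      rw [Finset.mem_insert, not_or] at hj
      simp [hj.1, hj.2]
    · intro c hc
      rw [← Finset.sum_subset (Finset.subset_univ (insert i S)), Finset.sum_insert hiS,
        ha c hc]
      · simp only [if_true, one_mul]
        rw [← Finset.sum_add_distrib]
        refine Finset.sum_eq_zero fun j hj => ?_
        rw [if_neg (by rintro rfl; exact hiS hj), if_pos hj]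
        ring
      · intro j _ hj
        rw [Finset.mem_insert, not_or] at hj
        simp [hj.1, hj.2]
  · intro H i
    obtain ⟨h, ⟨⟨S, hS, hz⟩, hh⟩, hi⟩ := H i
    have hiS : i ∈ S := by
      by_contra hn
      exact hi (hz i hn)
    refine ⟨S.erase i, Finset.notMem_erase _ _, ?_, fun j => -(h i)⁻¹ * h j, ?_⟩
    · rw [Finset.card_erase_of_mem hiS]; omega
    · intro c hc
      have h1 := hh c hc
      rw [← Finset.sum_subset (Finset.subset_univ S) (fun j _ hj => by simp [hz j hj]),
        ← Finset.add_sum_erase _ _ hiS] at h1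
      have h2 : ∑ j ∈ S.erase i, -(h i)⁻¹ * h j * c j
          = -(h i)⁻¹ * ∑ j ∈ S.erase i, h j * c j := by
        rw [Finset.mul_sum]
        exact Finset.sum_congr rfl fun j _ => by ring
      rw [h2, eq_neg_of_add_eq_zero_right h1]
      field_simp

/-- The supports of the sparse checks of a code with locality cover all coordinates. In a minimal
cover, every check has a coordinate of its own. -/
theorem HasLocality.exists_minimal_cover (hC : HasLocality C r) :
    ∃ (I : Finset (Fin n)) (h : Fin n → Fin n → F) (R : Fin n → Finset (Fin n))
      (p : Fin n → Fin n),
      (∀ i, IsSparseCheck C (r + 1) (h i)) ∧ (∀ i, (R i).card ≤ r + 1) ∧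
      (∀ i, ∀ j ∉ R i, h i j = 0) ∧ I.biUnion R = Finset.univ ∧
      (∀ i ∈ I, h i (p i) ≠ 0) ∧ ∀ i ∈ I, ∀ j ∈ I, j ≠ i → h j (p i) = 0 := by
  classical
  choose h hh hi using hasLocality_iff_exists_isSparseCheck.1 hC
  let R : Fin n → Finset (Fin n) := fun i => Finset.univ.filter fun j => h i j ≠ 0
  obtain ⟨I, hI, hmin⟩ := Finset.exists_min_image
    (Finset.univ.filter fun I : Finset (Fin n) => I.biUnion R = Finset.univ) Finset.card
    ⟨Finset.univ, by
      rw [Finset.mem_filter]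
      refine ⟨Finset.mem_univ _, Finset.eq_univ_iff_forall.2 fun j => ?_⟩
      exact Finset.mem_biUnion.2 ⟨j, Finset.mem_univ _, by simp [R, hi j]⟩⟩
  simp only [Finset.mem_filter, Finset.mem_univ, true_and] at hI hmin
  have hp : ∀ i ∈ I, ∃ x, x ∉ (I.erase i).biUnion R := by
    intro i hiI
    by_contra hn
    push Not at hn
    have := hmin _ (Finset.eq_univ_iff_forall.2 hn)
    rw [Finset.card_erase_of_mem hiI] at this
    have := Finset.card_pos.2 ⟨i, hiI⟩
    omega
  have hp' : ∀ i, ∃ x, i ∈ I → x ∉ (I.erase i).biUnion R := by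
    intro i
    by_cases hiI : i ∈ I
    · obtain ⟨x, hx⟩ := hp i hiI
      exact ⟨x, fun _ => hx⟩
    · exact ⟨i, fun h => absurd h hiI⟩
  choose p hp using hp'
  have hoff : ∀ i ∈ I, ∀ j ∈ I, j ≠ i → h j (p i) = 0 := by
    intro i hiI j hj hji
    by_contra hn
    exact hp i hiI (Finset.mem_biUnion.2 ⟨j, Finset.mem_erase.2 ⟨hji, hj⟩, by simp [R, hn]⟩)
  refine ⟨I, h, R, p, hh, fun i => ?_, fun i j hj => ?_, hI, fun i hiI => ?_, hoff⟩
  · obtain ⟨S, hS, hz⟩ := (hh i).1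
    refine (Finset.card_le_card fun j hj => ?_).trans hS
    by_contra hn
    exact (Finset.mem_filter.1 hj).2 (hz j hn)
  · by_contra hn
    exact hj (by simp [R, hn])
  · have h1 : p i ∈ I.biUnion R := by rw [hI]; exact Finset.mem_univ _
    obtain ⟨j, hj, hjp⟩ := Finset.mem_biUnion.1 h1
    by_cases hji : j = i
    · subst hji
      exact (Finset.mem_filter.1 hjp).2
    · exact absurd (hoff i hiI j hj hji) (Finset.mem_filter.1 hjp).2

theorem exists_mem_ne_zero_of_card_lt_finrank {W : Finset (Fin n)}
    (hW : W.card < Module.finrank F C) : ∃ x ∈ C, x ≠ 0 ∧ ∀ j ∈ W, x j = 0 := by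
  let f : C →ₗ[F] (W → F) := (LinearMap.funLeft F F (Subtype.val : W → Fin n)) ∘ₗ C.subtype
  have hf : LinearMap.ker f ≠ ⊥ := f.ker_ne_bot_of_finrank_lt (by simpa using hW)
  obtain ⟨x, hx, hx0⟩ := Submodule.exists_mem_ne_zero_of_ne_bot hf
  refine ⟨x, x.2, by simpa using hx0, fun j hj => ?_⟩
  exact congrFun (LinearMap.mem_ker.1 hx) ⟨j, hj⟩

/-- Every check that has a coordinate of its own within `U` saves one of the conditions that force
a codeword to vanish on `U`. -/
theorem exists_mem_ne_zero_of_card_lt_finrank_add {J : Finset (Fin n)} {U : Finset (Fin n)}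
    {h : Fin n → Fin n → F} {p : Fin n → Fin n}
    (hC : ∀ i ∈ J, ∀ c ∈ C, ∑ j, h i j * c j = 0) (hU : ∀ i ∈ J, ∀ j ∉ U, h i j = 0)
    (hp : ∀ i ∈ J, h i (p i) ≠ 0) (hoff : ∀ i ∈ J, ∀ j ∈ J, j ≠ i → h j (p i) = 0)
    (hcard : U.card < Module.finrank F C + J.card) :
    ∃ x ∈ C, x ≠ 0 ∧ ∀ j ∈ U, x j = 0 := by
  classical
  have hinj : Set.InjOn p J := by
    intro i hi j hj hij
    by_contra hne
    have := hoff j hj i hi hne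
    rw [← hij] at this
    exact hp i hi this
  have hsub : J.image p ⊆ U := by
    intro x hx
    obtain ⟨i, hi, rfl⟩ := Finset.mem_image.1 hx
    by_contra hn
    exact hp i hi (hU i hi _ hn)
  have hc : (U \ J.image p).card + J.card = U.card := by
    rw [← Finset.card_image_of_injOn hinj]
    exact Finset.card_sdiff_add_card_eq_card hsub
  obtain ⟨x, hx, hx0, hxW⟩ := exists_mem_ne_zero_of_card_lt_finrank (C := C)
    (W := U \ J.image p) (by omega)
  refine ⟨x, hx, hx0, fun j hj => ?_⟩
  by_cases hjp : j ∈ J.image p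
  · obtain ⟨i, hi, rfl⟩ := Finset.mem_image.1 hjp
    have h1 := hC i hi x hx
    rw [Finset.sum_eq_single (p i)] at h1
    · exact (mul_eq_zero.1 h1).resolve_left (hp i hi)
    · intro j _ hji
      by_cases hjU : j ∈ U
      · by_cases hjP : j ∈ J.image p
        · obtain ⟨i', hi', rfl⟩ := Finset.mem_image.1 hjP
          rw [hoff i' hi' i hi (by rintro rfl; exact hji rfl), zero_mul]
        · rw [hxW j (Finset.mem_sdiff.2 ⟨hjU, hjP⟩), mul_zero]
      · rw [hU i hi j hjU, zero_mul]
    · simp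
  · exact hxW j (Finset.mem_sdiff.2 ⟨hj, hjp⟩)

theorem IsMinDist.le_of_vanishing {d : ℕ} (hd : IsMinDist C d) {U : Finset (Fin n)} {x : Fin n → F}
    (hx : x ∈ C) (hx0 : x ≠ 0) (hU : ∀ j ∈ U, x j = 0) : d + U.card ≤ n := by
  classical
  have h1 := hd.2 ⟨x, hx, 0, C.zero_mem, hx0, rfl⟩
  rw [hammingDist_zero_right, hammingNorm] at h1
  have h2 : (Finset.univ.filter fun j => x j ≠ 0).card ≤ Uᶜ.card := by
    refine Finset.card_le_card fun j hj => ?_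
    rw [Finset.mem_compl]
    exact fun hjU => (Finset.mem_filter.1 hj).2 (hU j hjU)
  have h3 : U.card + Uᶜ.card = n := by simp
  have h4 : d ≤ (Finset.univ.filter fun j => x j ≠ 0).card := by convert h1
  omega

theorem exists_isMinDist (hC : 0 < Module.finrank F C) : ∃ d, IsMinDist C d := by
  obtain ⟨x, hx, hx0, -⟩ := exists_mem_ne_zero_of_card_lt_finrank (C := C) (W := ∅) (by simp [hC])
  classical
  let s := {m : ℕ | ∃ x ∈ C, ∃ y ∈ C, x ≠ y ∧ hammingDist x y = m}
  have hs : s.Nonempty := ⟨_, x, hx, 0, C.zero_mem, hx0, rfl⟩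
  refine ⟨sInf s, ?_⟩
  unfold IsMinDist
  convert! (show IsLeast s (sInf s) from ⟨Nat.sInf_mem hs, fun m hm => Nat.sInf_le hm⟩)

theorem IsMinDist.le_of_forall_support {d e : ℕ} (hd : IsMinDist C d)
    (H : ∀ B : Finset (Fin n), B.card + 1 = e → ∀ x ∈ C, (∀ j ∉ B, x j = 0) → x = 0)
    (he : e ≤ n + 1) : e ≤ d := by
  classical
  obtain ⟨x, hx, y, hy, hxy, rfl⟩ := hd.1
  by_contra hlt
  push Not at hlt
  have hlt' : (Finset.univ.filter fun j => x j ≠ y j).card < e := by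
    refine lt_of_eq_of_lt ?_ hlt
    unfold hammingDist
    congr!
  obtain ⟨B, hB, -, hBc⟩ := Finset.exists_subsuperset_card_eq (n := e - 1)
    (Finset.subset_univ (Finset.univ.filter fun j => x j ≠ y j)) (by omega)
    (by simp; omega)
  refine hxy (sub_eq_zero.1 (H B (by omega) (x - y) (C.sub_mem hx hy) fun j hj => ?_))
  by_contra hn
  exact hj (hB (by simpa [sub_eq_zero] using hn))

/-- The rate bound `k ≤ n r / (r + 1)`, in the form `k (r + 1) ≤ n r`. -/
theorem IsLRC.mul_le (hC : IsLRC C k r) : k * (r + 1) ≤ n * r := by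
  obtain ⟨I, h, R, p, hh, hR, hz, hI, hp, hoff⟩ := hC.2.exists_minimal_cover
  have h1 : n ≤ I.card * (r + 1) := by
    have := Finset.card_biUnion_le_card_mul I R (r + 1) fun i _ => hR i
    rwa [hI, Finset.card_univ, Fintype.card_fin] at this
  have h2 : k + I.card ≤ n := by
    by_contra hlt
    obtain ⟨x, hx, hx0, hxU⟩ := exists_mem_ne_zero_of_card_lt_finrank_add (J := I)
      (U := Finset.univ) (fun i _ => (hh i).2) (by simp) hp hoff
      (by rw [hC.1, Finset.card_univ, Fintype.card_fin]; omega)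
    exact hx0 (funext fun j => hxU j (Finset.mem_univ _))
  nlinarith

/-- If the checks in `J` involve few coordinates, then some nonzero codeword vanishes on a set of
`k + J.card - 1` coordinates, which bounds the minimum distance. -/
theorem IsMinDist.add_le_of_cover {d : ℕ} (hd : IsMinDist C d) (hk : Module.finrank F C = k)
    {I : Finset (Fin n)} {h : Fin n → Fin n → F} {R : Fin n → Finset (Fin n)}
    {p : Fin n → Fin n} (hh : ∀ i, IsSparseCheck C (r + 1) (h i))
    (hz : ∀ i, ∀ j ∉ R i, h i j = 0) (hp : ∀ i ∈ I, h i (p i) ≠ 0)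
    (hoff : ∀ i ∈ I, ∀ j ∈ I, j ≠ i → h j (p i) = 0) {J : Finset (Fin n)} (hJ : J ⊆ I)
    (hU : (J.biUnion R).card < k + J.card) (hn : k + J.card ≤ n + 1) :
    d + k + J.card ≤ n + 1 := by
  obtain ⟨U, hJU, -, hUc⟩ := Finset.exists_subsuperset_card_eq (n := k + J.card - 1)
    (Finset.subset_univ (J.biUnion R)) (by omega) (by simp; omega)
  obtain ⟨x, hx, hx0, hxU⟩ := exists_mem_ne_zero_of_card_lt_finrank_add (J := J) (U := U) (C := C)
    (fun i _ => (hh i).2)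
    (fun i hi j hj => hz i j fun hjR => hj (hJU (Finset.mem_biUnion.2 ⟨i, hi, hjR⟩)))
    (fun i hi => hp i (hJ hi)) (fun i hi j hj => hoff i (hJ hi) j (hJ hj)) (by omega)
  have := hd.le_of_vanishing hx hx0 hxU
  omega

end Codes

/-! ### Subspaces in general position -/

/-- Over a large field there is a `k`-dimensional subspace that meets finitely many given subspaces
of codimension at least `k` trivially: its basis vectors are chosen one after the other, outside
finitely many proper subspaces. -/
theorem exists_finrank_eq_forall_disjoint {F V ι : Type*} [Field F] [AddCommGroup V] [Module F V]
    [FiniteDimensional F V] [Fintype ι] [Nonempty ι] (W : ι → Submodule F V)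
    (hF : (Fintype.card ι : ℕ∞) < ENat.card F) (k : ℕ)
    (hW : ∀ i, Module.finrank F (W i) + k ≤ Module.finrank F V) :
    ∃ C : Submodule F V, Module.finrank F C = k ∧ ∀ i, Disjoint (W i) C := by
  induction k with
  | zero => exact ⟨⊥, finrank_bot F V, fun i => disjoint_bot_right⟩
  | succ k ih =>
    obtain ⟨C, hC, hd⟩ := ih fun i => by have := hW i; omega
    have hne : ∀ i, W i ⊔ C ≠ ⊤ := by
      intro i hi
      have h1 := Submodule.finrank_add_le_finrank_add_finrank (W i) C
      have h2 := hW i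
      rw [hi, finrank_top] at h1
      omega
    have hss := Submodule.iUnion_ssubset_of_forall_ne_top_of_card_lt Finset.univ _ hne
      (by rwa [Finset.card_univ])
    obtain ⟨v, -, hv⟩ := Set.exists_of_ssubset hss
    simp only [Finset.mem_univ, Set.iUnion_true, Set.mem_iUnion, SetLike.mem_coe, not_exists] at hv
    have hvC : v ∉ C := fun h => hv (Classical.arbitrary ι) (Submodule.mem_sup_right h)
    refine ⟨C ⊔ Submodule.span F {v}, ?_, fun i => ?_⟩
    · have h1 := Submodule.finrank_sup_add_finrank_inf_eq C (Submodule.span F {v})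
      have h2 : C ⊓ Submodule.span F {v} = ⊥ := by
        rw [← disjoint_iff, Submodule.disjoint_span_singleton' (by rintro rfl; exact hvC C.zero_mem)]
        exact hvC
      rw [h2, finrank_bot, finrank_span_singleton (by rintro rfl; exact hvC C.zero_mem), hC] at h1
      exact h1
    · rw [Submodule.disjoint_def]
      intro x hxW hx
      obtain ⟨y, hy, z, hz, rfl⟩ := Submodule.mem_sup.1 hx
      obtain ⟨a, rfl⟩ := Submodule.mem_span_singleton.1 hz
      by_cases ha : a = 0
      · subst ha
        rw [zero_smul, add_zero] at hxW ⊢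
        exact (Submodule.disjoint_def.1 (hd i)) y hxW hy
      · refine absurd ?_ (hv i)
        have h1 : a • v ∈ W i ⊔ C := by
          rw [← add_sub_cancel_left y (a • v)]
          exact Submodule.sub_mem _ (Submodule.mem_sup_left hxW) (Submodule.mem_sup_right hy)
        exact (Submodule.smul_mem_iff _ ha).1 h1

/-! ### The construction -/

/-- If `N` indices are distributed as evenly as possible over `p` classes, then `K` of them always
meet more than `c` classes, provided that `p` is large enough. -/
theorem lt_card_image_mod {N p K c q : ℕ} (hp : 0 < p) (hcp : c ≤ p) (hq : c * q < K)
    (hq' : K ≤ c * (q + 1)) (hN : N < K + q * (p - c)) (J : Finset (Fin N)) (hJ : K ≤ J.card) :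
    c < (J.image fun i : Fin N => (⟨i % p, Nat.mod_lt _ hp⟩ : Fin p)).card := by
  by_contra hle
  push Not at hle
  set f : Fin N → Fin p := fun i => ⟨i % p, Nat.mod_lt _ hp⟩
  have hfib : ∀ v : Fin p, (J.filter fun i => f i = v).card
      ≤ N / p + if (v : ℕ) < N % p then 1 else 0 := by
    intro v
    have h1 := Nat.count_modEq_card N hp v
    rw [Nat.mod_eq_of_lt v.2, Nat.count_eq_card_filter_range] at h1
    rw [← h1, ← Finset.card_map Fin.valEmbedding]
    refine Finset.card_le_card fun x hx => ?_
    obtain ⟨i, hi, rfl⟩ := Finset.mem_map.1 hx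
    have h2 := congrArg Fin.val (Finset.mem_filter.1 hi).2
    simp only [f] at h2
    simp [Nat.ModEq, h2, Nat.mod_eq_of_lt v.2]
  have hsum : J.card ≤ (J.image f).card * (N / p) + min (J.image f).card (N % p) := by
    rw [Finset.card_eq_sum_card_image f J]
    refine (Finset.sum_le_sum fun v _ => hfib v).trans ?_
    rw [Finset.sum_add_distrib, Finset.sum_const, smul_eq_mul, Finset.sum_ite, Finset.sum_const_zero,
      add_zero, Finset.sum_const, smul_eq_mul, mul_one]
    refine Nat.add_le_add_left (le_min (Finset.card_le_card (Finset.filter_subset _ _)) ?_) _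
    rw [← Finset.card_map Fin.valEmbedding]
    refine (Finset.card_le_card fun x hx => ?_).trans (Finset.card_range _).le
    obtain ⟨v, hv, rfl⟩ := Finset.mem_map.1 hx
    simpa using (Finset.mem_filter.1 hv).2
  have hdm := Nat.div_add_mod N p
  obtain ⟨e, rfl⟩ := Nat.exists_eq_add_of_le hcp
  rw [Nat.add_sub_cancel_left] at hN
  set a := N / (c + e)
  set b := N % (c + e)
  have hs : J.card ≤ c * a + min c b :=
    hsum.trans (add_le_add (Nat.mul_le_mul_right _ hle) (min_le_min_right _ hle))
  rcases lt_trichotomy a q with h | h | h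
  · have h1 : c * a + c ≤ c * q := by rw [← Nat.mul_succ]; exact Nat.mul_le_mul_left _ h
    have := min_le_left c b
    omega
  · have := min_le_right c b
    rw [h] at hs hdm
    nlinarith
  · have h1 : (c + e) * (q + 1) ≤ (c + e) * a := Nat.mul_le_mul_left _ h
    nlinarith

section Construction

variable {F : Type} [Field F] {N r p : ℕ}

/-- The `N` local conditions: each of them involves `r` coordinates of its own and one coordinate
shared by all conditions of the same class. -/
def localMap (F : Type) [Field F] {N p : ℕ} (r : ℕ) (f : Fin N → Fin p) :
    ((Fin N × Fin r) ⊕ Fin p → F) →ₗ[F] (Fin N → F) :=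
  LinearMap.pi fun i =>
    (∑ j, LinearMap.proj (Sum.inl (i, j))) + LinearMap.proj (Sum.inr (f i))

@[simp]
theorem localMap_apply (f : Fin N → Fin p) (x : (Fin N × Fin r) ⊕ Fin p → F) (i : Fin N) :
    localMap F r f x i = ∑ j, x (Sum.inl (i, j)) + x (Sum.inr (f i)) := by
  simp [localMap]

/-- The local conditions have large rank on every large set `B` of coordinates: there are many
coordinates in `B` on which no nonzero solution is supported. They consist of one private
coordinate for each condition that has one in `B`, and of the shared coordinates in `B` of the
classes in which some condition has no private coordinate in `B`. -/
theorem exists_subset_forall_eq_zero {K c : ℕ} (hr : 1 ≤ r) (f : Fin N → Fin p)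
    (hf : ∀ J : Finset (Fin N), K ≤ J.card → c < (J.image f).card)
    (B : Finset ((Fin N × Fin r) ⊕ Fin p)) (hB : N * r + p < B.card + K * r + c + 1) :
    ∃ B' ⊆ B, N < B'.card + K ∧ ∀ x ∈ LinearMap.ker (localMap F r f),
      (∀ j ∉ B', x j = 0) → x = 0 := by
  classical
  set J : Finset (Fin N) := Finset.univ.filter fun i => ∀ j, Sum.inl (i, j) ∉ B with hJdef
  set T : Finset (Fin p) := (J.image f).filter fun v => Sum.inr v ∈ B with hTdef
  have hg : ∀ i, ∃ j, i ∉ J → Sum.inl (i, j) ∈ B := by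
    intro i
    by_cases hi : i ∈ J
    · exact ⟨⟨0, hr⟩, fun h => absurd hi h⟩
    · have : ∃ j, Sum.inl (i, j) ∈ B := by simpa [hJdef] using hi
      exact this.imp fun j hj _ => hj
  choose g hg using hg
  set P : Finset (Fin N × Fin r) := Jᶜ.image fun i => (i, g i) with hPdef
  have hPc : P.card = N - J.card := by
    rw [hPdef, Finset.card_image_of_injective _ fun i i' h => (Prod.ext_iff.1 h).1,
      Finset.card_compl, Fintype.card_fin]
  have hJN : J.card ≤ N := by simpa using Finset.card_le_univ J
  refine ⟨P.disjSum T, ?_, ?_, ?_⟩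
  · intro z hz
    rcases Finset.mem_disjSum.1 hz with ⟨z, h, rfl⟩ | ⟨v, h, rfl⟩
    · obtain ⟨i, hi, rfl⟩ := Finset.mem_image.1 h
      exact hg i (Finset.mem_compl.1 hi)
    · exact (Finset.mem_filter.1 h).2
  · rw [Finset.card_disjSum, hPc]
    by_contra hlt
    have hKJ : K + T.card ≤ J.card := by omega
    have himg := hf J (by omega)
    have hsub : B ⊆ (Jᶜ ×ˢ Finset.univ).disjSum (T ∪ (J.image f)ᶜ) := by
      rintro (⟨i, j⟩ | v) hz
      · rw [Finset.inl_mem_disjSum, Finset.mem_product, Finset.mem_compl]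
        refine ⟨fun hi => ?_, Finset.mem_univ _⟩
        exact (Finset.mem_filter.1 hi).2 j hz
      · rw [Finset.inr_mem_disjSum, Finset.mem_union, Finset.mem_compl]
        by_cases hv : v ∈ J.image f
        · exact Or.inl (Finset.mem_filter.2 ⟨hv, hz⟩)
        · exact Or.inr hv
    have h1 := Finset.card_le_card hsub
    rw [Finset.card_disjSum, Finset.card_product, Finset.card_compl, Finset.card_univ,
      Fintype.card_fin, Fintype.card_fin] at h1
    have h2 := Finset.card_union_le T (J.image f)ᶜ
    rw [Finset.card_compl, Fintype.card_fin] at h2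
    have h3 : (J.image f).card ≤ p := by simpa using Finset.card_le_univ (J.image f)
    obtain ⟨m, hm⟩ := Nat.exists_eq_add_of_le hJN
    obtain ⟨u, hu⟩ := Nat.exists_eq_add_of_le hKJ
    have h4 : N - J.card = m := by omega
    rw [h4] at h1
    have h5 : N * r = K * r + T.card * r + u * r + m * r := by rw [hm, hu]; ring
    have h6 : T.card ≤ T.card * r := Nat.le_mul_of_pos_right _ hr
    omega
  · intro x hx hx0
    have heq : ∀ i, ∑ j, x (Sum.inl (i, j)) + x (Sum.inr (f i)) = 0 := fun i => by
      rw [← localMap_apply, LinearMap.mem_ker.1 hx, Pi.zero_apply]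
    have hinl : ∀ i j, (i ∈ J ∨ j ≠ g i) → x (Sum.inl (i, j)) = 0 := by
      intro i j hij
      refine hx0 _ fun hmem => ?_
      rw [Finset.inl_mem_disjSum] at hmem
      obtain ⟨i', hi', he⟩ := Finset.mem_image.1 hmem
      obtain ⟨rfl, rfl⟩ := Prod.ext_iff.1 he
      exact hij.elim (fun h => Finset.mem_compl.1 hi' h) fun h => h rfl
    have hinr : ∀ v, x (Sum.inr v) = 0 := by
      intro v
      by_cases hv : v ∈ T
      · obtain ⟨i, hi, rfl⟩ := Finset.mem_image.1 (Finset.mem_filter.1 hv).1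
        have := heq i
        rwa [Finset.sum_eq_zero fun j _ => hinl i j (Or.inl hi), zero_add] at this
      · exact hx0 _ fun hmem => hv (Finset.inr_mem_disjSum.1 hmem)
    funext z
    rcases z with ⟨i, j⟩ | v
    · by_cases hj : j = g i
      · subst hj
        have := heq i
        rwa [hinr, add_zero, Finset.sum_eq_single (g i)
          (fun j _ hj => hinl i j (Or.inr hj)) (by simp)] at this
      · exact hinl i j (Or.inr hj)
    · exact hinr v

/-- Among the solutions of the local conditions, those supported on a large set `B` form a space of
small dimension, so that a general `k`-dimensional space of solutions avoids all of them. -/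
theorem exists_submodule_le_ker_localMap {K c k b : ℕ} (hr : 1 ≤ r) (f : Fin N → Fin p)
    (hf : ∀ J : Finset (Fin N), K ≤ J.card → c < (J.image f).card)
    (hb : b + k + K = N * r + p + 1) (hk : k + K ≤ K * r + c + 1) (hbn : b ≤ N * r + p)
    (hF : ((2 ^ (N * r + p) : ℕ) : ℕ∞) < ENat.card F) :
    ∃ C ≤ LinearMap.ker (localMap F r f), Module.finrank F C = k ∧
      ∀ B : Finset ((Fin N × Fin r) ⊕ Fin p), B.card = b →
        ∀ x ∈ C, (∀ j ∉ B, x j = 0) → x = 0 := by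
  classical
  set L := LinearMap.ker (localMap F r f) with hLdef
  have hκ : Fintype.card ((Fin N × Fin r) ⊕ Fin p) = N * r + p := by simp
  have hL : N * r + p ≤ Module.finrank F L + N := by
    have h1 := (localMap F r f).finrank_range_add_finrank_ker
    rw [← hLdef] at h1
    have h2 := (LinearMap.range (localMap F r f)).finrank_le
    rw [Module.finrank_fintype_fun_eq_card, hκ] at h1
    rw [Module.finrank_fin_fun] at h2
    omega
  let ι := {B : Finset ((Fin N × Fin r) ⊕ Fin p) // B.card = b}
  obtain ⟨B₀, -, hB₀⟩ := Finset.exists_subset_card_eq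
    (s := (Finset.univ : Finset ((Fin N × Fin r) ⊕ Fin p))) (n := b)
    (by rw [Finset.card_univ, hκ]; exact hbn)
  have : Nonempty ι := ⟨⟨B₀, hB₀⟩⟩
  let W : ι → Submodule F L := fun B =>
    { carrier := {x | ∀ j ∉ B.1, (x : (Fin N × Fin r) ⊕ Fin p → F) j = 0}
      add_mem' := fun {x y} hx hy j hj => by
        rw [Submodule.coe_add, Pi.add_apply, hx j hj, hy j hj, add_zero]
      zero_mem' := fun j _ => rfl
      smul_mem' := fun a x hx j hj => by
        rw [Submodule.coe_smul, Pi.smul_apply, hx j hj, smul_zero] }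
  have hcard : (Fintype.card ι : ℕ∞) < ENat.card F := by
    refine lt_of_le_of_lt ?_ hF
    have h1 := Fintype.card_subtype_le
      fun B : Finset ((Fin N × Fin r) ⊕ Fin p) => B.card = b
    rw [Fintype.card_finset, hκ] at h1
    exact_mod_cast h1
  have hW : ∀ B, Module.finrank F (W B) + k ≤ Module.finrank F L := by
    rintro ⟨B, hBc⟩
    obtain ⟨B', hB', hB'c, hB'0⟩ := exists_subset_forall_eq_zero (F := F) hr f hf B (by omega)
    let g : W ⟨B, hBc⟩ →ₗ[F] ((B \ B' : Finset _) → F) :=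
      LinearMap.funLeft F F Subtype.val ∘ₗ L.subtype ∘ₗ (W ⟨B, hBc⟩).subtype
    have hg : Function.Injective g := by
      intro x y hxy
      refine Subtype.ext (Subtype.ext (sub_eq_zero.1 (hB'0 (x.1.1 - y.1.1)
        (L.sub_mem x.1.2 y.1.2) fun j hj => ?_)))
      rw [Pi.sub_apply, sub_eq_zero]
      by_cases hjB : j ∈ B
      · exact congrFun hxy ⟨j, Finset.mem_sdiff.2 ⟨hjB, hj⟩⟩
      · exact (x.2 j hjB).trans (y.2 j hjB).symm
    have h1 := LinearMap.finrank_le_finrank_of_injective hg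
    rw [Module.finrank_fintype_fun_eq_card, Fintype.card_coe,
      Finset.card_sdiff_of_subset hB'] at h1
    have h2 := Finset.card_le_card hB'
    omega
  obtain ⟨C, hC, hd⟩ := exists_finrank_eq_forall_disjoint W hcard k hW
  refine ⟨C.map L.subtype, Submodule.map_subtype_le _ _, ?_, ?_⟩
  · rw [← hC]
    exact Submodule.finrank_map_subtype_eq L C
  · rintro B hBc _ ⟨x, hx, rfl⟩ hx0
    have := Submodule.disjoint_def.1 (hd ⟨B, hBc⟩) x hx0 hx
    rw [this, map_zero]

end Construction

theorem hasLocality_map_funCongrLeft {F : Type} [Field F] {n N r p : ℕ} {f : Fin N → Fin p}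
    (hf : Function.Surjective f) (e : Fin n ≃ (Fin N × Fin r) ⊕ Fin p)
    {C : Submodule F ((Fin N × Fin r) ⊕ Fin p → F)} (hC : C ≤ LinearMap.ker (localMap F r f)) :
    HasLocality (C.map (LinearEquiv.funCongrLeft F F e : _ →ₗ[F] (Fin n → F))) r := by
  classical
  rw [hasLocality_iff_exists_isSparseCheck]
  let h : Fin N → (Fin N × Fin r) ⊕ Fin p → F := fun i =>
    Sum.elim (fun z => if z.1 = i then 1 else 0) (fun v => if v = f i then 1 else 0)
  have hcheck : ∀ i, IsSparseCheck
      (C.map (LinearEquiv.funCongrLeft F F e : _ →ₗ[F] (Fin n → F))) (r + 1) (h i ∘ e) := by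
    intro i
    refine ⟨⟨(({i} ×ˢ Finset.univ : Finset (Fin N × Fin r)).disjSum {f i}).map
      e.symm.toEmbedding, ?_, ?_⟩, ?_⟩
    · simp
    · intro j hj
      have hj' : e j ∉ ({i} ×ˢ Finset.univ : Finset (Fin N × Fin r)).disjSum {f i} := by
        intro hmem
        exact hj (Finset.mem_map.2 ⟨e j, hmem, by simp⟩)
      rw [Function.comp_apply]
      rcases hz : e j with ⟨i', j'⟩ | v
      · have : i' ≠ i := by
          rintro rfl
          exact hj' (by simp [hz])
        simp [h, this]
      · have : v ≠ f i := by
          rintro rfl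
          exact hj' (by simp [hz])
        simp [h, this]
    · rintro _ ⟨x, hx, rfl⟩
      have h1 : localMap F r f x i = 0 := by
        rw [LinearMap.mem_ker.1 (hC hx), Pi.zero_apply]
      rw [localMap_apply] at h1
      rw [← h1]
      calc ∑ j, (h i ∘ e) j * (LinearEquiv.funCongrLeft F F e x) j
          = ∑ j, (fun z => h i z * x z) (e j) := rfl
        _ = ∑ z, h i z * x z := Equiv.sum_comp e fun z => h i z * x z
        _ = _ := by
          rw [Fintype.sum_sum_type, Fintype.sum_prod_type, Finset.sum_eq_single i,
            Finset.sum_eq_single (f i)]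
          · simp [h]
          · intro v _ hv; simp [h, hv]
          · simp
          · intro i' _ hi'; simp [h, hi']
          · simp
  intro j
  rcases hz : e j with ⟨i, j'⟩ | v
  · exact ⟨_, hcheck i, by simp [h, hz]⟩
  · obtain ⟨i, rfl⟩ := hf v
    exact ⟨_, hcheck i, by simp [h, hz]⟩

/-- Codes attaining the Singleton-type bound exist when the local conditions can be distributed
over classes in such a way that any `K` of them meet more than `c` classes. -/
theorem exists_mem_lrcMinDists_ge {n N r p K c k : ℕ} (hr : 1 ≤ r) (hk0 : 0 < k)
    {f : Fin N → Fin p}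
    (hf : ∀ J : Finset (Fin N), K ≤ J.card → c < (J.image f).card)
    (hsurj : Function.Surjective f) (hn : n = N * r + p) (hkn : k + K ≤ n)
    (hk : k + K ≤ K * r + c + 1) :
    ∃ d ∈ lrcMinDists n k r, n + 2 ≤ d + k + K := by
  obtain ⟨P, hP, hprime⟩ := Nat.exists_infinite_primes (2 ^ n + 1)
  have : Fact P.Prime := ⟨hprime⟩
  have hF : ((2 ^ (N * r + p) : ℕ) : ℕ∞) < ENat.card (ZMod P) := by
    rw [ENat.card_eq_coe_fintype_card, ZMod.card, ← hn]
    exact_mod_cast hP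
  obtain ⟨C, hCL, hCk, hC⟩ := exists_submodule_le_ker_localMap (k := k) (b := n + 1 - k - K)
    hr f hf (by omega) hk (by omega) hF
  let e : Fin n ≃ (Fin N × Fin r) ⊕ Fin p := Fintype.equivOfCardEq (by simp [hn])
  let C' := C.map (LinearEquiv.funCongrLeft (ZMod P) (ZMod P) e : _ →ₗ[ZMod P] (Fin n → ZMod P))
  have hC'k : Module.finrank (ZMod P) C' = k := by
    rw [← hCk]
    exact LinearEquiv.finrank_map_eq _ C
  obtain ⟨d, hd⟩ := exists_isMinDist (C := C') (by omega)
  refine ⟨d, ⟨ZMod P, inferInstance, inferInstance, C',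
    ⟨hC'k, hasLocality_map_funCongrLeft hsurj e hCL⟩, hd⟩, ?_⟩
  have h1 := hd.le_of_forall_support (e := n + 2 - k - K) ?_ (by omega)
  · omega
  · rintro B hB _ ⟨x, hx, rfl⟩ hx0
    have : x = 0 := by
      refine hC (B.map e.toEmbedding) (by rw [Finset.card_map]; omega) x hx fun z hz => ?_
      have h2 := hx0 (e.symm z) fun hmem => hz (Finset.mem_map.2 ⟨_, hmem, by simp⟩)
      simpa [LinearEquiv.funCongrLeft, LinearMap.funLeft] using h2
    rw [this, map_zero]

/-! ### The criterion -/

/-- The Singleton-type bound, with `K = ⌈k / r⌉`: the union of any `K - 1` checks of a minimal cover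
is small enough for a nonzero codeword to vanish on a slightly larger set. -/
theorem singleton_bound {n k r K d : ℕ} (hkn : k + K ≤ n) (hK : 1 ≤ K) (hK' : K * r < k + r)
    (hd : d ∈ lrcMinDists n k r) : d + k + K ≤ n + 2 := by
  obtain ⟨F, _, _, C, hC, hd⟩ := hd
  obtain ⟨I, h, R, p, hh, hR, hz, hI, hp, hoff⟩ := hC.2.exists_minimal_cover
  have h1 : n ≤ I.card * (r + 1) := by
    have := Finset.card_biUnion_le_card_mul I R (r + 1) fun i _ => hR i
    rwa [hI, Finset.card_univ, Fintype.card_fin] at this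
  obtain ⟨K, rfl⟩ := Nat.exists_eq_add_of_le' hK
  have h2 : K ≤ I.card := by
    by_contra hlt
    have : I.card * (r + 1) ≤ K * (r + 1) := Nat.mul_le_mul_right _ (by omega)
    nlinarith
  obtain ⟨J, hJ, hJc⟩ := Finset.exists_subset_card_eq h2
  have h3 := Finset.card_biUnion_le_card_mul J R (r + 1) fun i _ => hR i
  have := hd.add_le_of_cover hC.1 hh hz hp hoff hJ (by rw [hJc] at h3 ⊢; nlinarith) (by omega)
  omega

/-- If a code attains the Singleton-type bound, then any `K` checks of a minimal cover involve at
least `k + K` coordinates, and hence the cover as a whole has little room for overlaps. -/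
theorem add_div_le_of_mem_lrcMinDists {n k r K N c q d : ℕ} (hkn : k + K ≤ n)
    (hk : k + K = K * r + c + 1) (hN : N * (r + 1) < n + (r + 1)) (hKN : K ≤ N)
    (hq : K ≤ c * (q + 1)) (hd : d ∈ lrcMinDists n k r) (hdn : n + 2 ≤ d + k + K) :
    N * r + c + 1 + (N - K) / q ≤ n := by
  obtain ⟨F, _, _, C, hC, hd⟩ := hd
  obtain ⟨I, h, R, p, hh, hR, hz, hI, hp, hoff⟩ := hC.2.exists_minimal_cover
  have h1 : n ≤ I.card * (r + 1) := by
    have := Finset.card_biUnion_le_card_mul I R (r + 1) fun i _ => hR i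
    rwa [hI, Finset.card_univ, Fintype.card_fin] at this
  have hNI : N ≤ I.card := by
    by_contra hlt
    have : (I.card + 1) * (r + 1) ≤ N * (r + 1) := Nat.mul_le_mul_right _ (by omega)
    nlinarith
  by_contra hlt
  have hexc : unionExcess R r I ≤ c + ((I.card - K) / q : ℕ) := by
    have h2 : (N - K) / q ≤ (I.card - K) / q := Nat.div_le_div_right (by omega)
    have h3 : N * r ≤ I.card * r := Nat.mul_le_mul_right _ hNI
    rw [unionExcess, hI, Finset.card_univ, Fintype.card_fin, mul_comm]
    have : n ≤ c + (I.card - K) / q + I.card * r := by omega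
    have : (n : ℤ) ≤ c + ((I.card - K) / q : ℕ) + I.card * r := by exact_mod_cast this
    linarith
  obtain ⟨J, hJ, hJc, hJf⟩ := exists_subset_card_eq_unionExcess_le hR hq I (by omega) hexc
  have hU : (J.biUnion R).card < k + J.card := by
    rw [unionExcess, hJc, mul_comm] at hJf
    have : ((J.biUnion R).card : ℤ) ≤ ((K * r + c : ℕ) : ℤ) := by push_cast; linarith
    have := Int.ofNat_le.1 this
    omega
  have := hd.add_le_of_cover hC.1 hh hz hp hoff hJ hU (by omega)
  omega

theorem exists_nat_ceil_div (a b : ℕ) (hb : 0 < b) :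
    ∃ m : ℕ, ⌈(a : ℚ) / b⌉ = m ∧ a ≤ m * b ∧ m * b < a + b := by
  have hb' : (0 : ℚ) < b := by exact_mod_cast hb
  refine ⟨⌈(a : ℚ) / b⌉₊, ?_, ?_, ?_⟩
  · exact (Int.natCast_ceil_eq_ceil (by positivity)).symm
  · have := Nat.le_ceil ((a : ℚ) / b)
    rw [div_le_iff₀ hb'] at this
    exact_mod_cast this
  · have := Nat.ceil_lt_add_one (show (0 : ℚ) ≤ (a : ℚ) / b by positivity)
    rw [← sub_lt_iff_lt_add, lt_div_iff₀ hb', sub_mul, one_mul, sub_lt_iff_lt_add] at this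
    exact_mod_cast this

theorem ceil_natCast_succ_div (a : ℕ) {b : ℕ} (hb : 0 < b) :
    ⌈((a + 1 : ℕ) : ℚ) / b⌉ = ((a / b + 1 : ℕ) : ℤ) := by
  have hb' : (0 : ℚ) < b := by exact_mod_cast hb
  rw [Int.ceil_eq_iff]
  push_cast
  rw [add_sub_cancel_right, lt_div_iff₀ hb', div_le_iff₀ hb']
  have h1 := Nat.lt_mul_div_succ a hb
  have h2 := Nat.div_mul_le_self a b
  rw [mul_comm] at h1
  constructor
  · exact_mod_cast Nat.lt_succ_of_le h2
  · exact_mod_cast h1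

theorem mainTheorem3 (n k r : ℕ) (hr : 1 ≤ r) (hrk : r ≤ k) (hkn : k < n)
    (hex : ∃ (F : Type) (_ : Field F) (_ : Finite F) (C : Submodule F (Fin n → F)), IsLRC C k r)
    (h : kTwo k r < kOne k r - 1) :
    (largestMinDist n k r : ℤ) = dStar n k r ↔
      nTwo n r ≤ nOne n r -
        (⌈((nOne n r - kOne k r + 1 : ℤ) : ℚ) /
            (⌊((kOne k r - 1 : ℤ) : ℚ) / ((kOne k r - kTwo k r - 1 : ℤ) : ℚ)⌋ : ℚ)⌉
          + kOne k r - kTwo k r - 1) := by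
  obtain ⟨K, hKe, hK1, hK2⟩ := exists_nat_ceil_div k r hr
  obtain ⟨N, hNe, hN1, hN2⟩ := exists_nat_ceil_div n (r + 1) (by omega)
  have hrate : k * (r + 1) ≤ n * r := by
    obtain ⟨F, _, _, C, hC⟩ := hex
    exact hC.mul_le
  have hne : (lrcMinDists n k r).Nonempty := by
    obtain ⟨F, _, hfin, C, hC⟩ := hex
    obtain ⟨d, hd⟩ := exists_isMinDist (C := C) (by rw [hC.1]; omega)
    exact ⟨d, F, _, hfin, C, hC, hd⟩
  have hgr := largestMinDist_isGreatest hne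
  have hK0 : 1 ≤ K := by
    rcases Nat.eq_zero_or_pos K with rfl | h
    · omega
    · exact h
  -- `K = ⌈k / r⌉ ≤ n - k` and `N = ⌈n / (r + 1)⌉ ≤ n - k`
  have hKn : k + K ≤ n := by
    by_contra hlt
    have : n * r ≤ (k + (K - 1)) * r := Nat.mul_le_mul_right _ (by omega)
    obtain ⟨K, rfl⟩ := Nat.exists_eq_add_of_le' hK0
    rw [Nat.add_sub_cancel] at this
    nlinarith
  have hKN : K ≤ N := by
    by_contra hlt
    obtain ⟨K, rfl⟩ := Nat.exists_eq_add_of_le' hK0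
    have : N * (r + 1) ≤ K * (r + 1) := Nat.mul_le_mul_right _ (by omega)
    nlinarith
  have hkOne : kOne k r = K := hKe
  have hnOne : nOne n r = N := by
    rw [← hNe, nOne]; push_cast; rfl
  have hkTwo : kTwo k r = K * r - k := by rw [kTwo, hkOne]
  have hnTwo : nTwo n r = N * (r + 1) - n := by rw [nTwo, hnOne]
  have hdStar : dStar n k r = n - k - K + 2 := by rw [dStar, hKe]
  rw [hkTwo, hkOne] at h
  -- `c = k₁ - k₂ - 1`
  obtain ⟨c, hc⟩ : ∃ c : ℕ, k + K = K * r + c + 1 := by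
    obtain ⟨c, hc⟩ := Int.eq_ofNat_of_zero_le
      (show (0 : ℤ) ≤ k + K - K * r - 1 by linarith)
    refine ⟨c, ?_⟩
    zify
    linarith
  have hcz : (k : ℤ) + K = K * r + c + 1 := by exact_mod_cast hc
  have hc0 : 0 < c := by
    by_contra h0
    obtain rfl : c = 0 := by omega
    push_cast at hcz
    linarith
  have hcK : c + 1 ≤ K := by nlinarith
  obtain ⟨q, hqdef⟩ : ∃ q, q = (K - 1) / c := ⟨_, rfl⟩
  have hq0 : 0 < q := hqdef ▸ Nat.div_pos (by omega) hc0
  have hcq : c * q < K := by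
    have := Nat.mul_div_le (K - 1) c
    rw [← hqdef] at this
    omega
  have hqK : K ≤ c * (q + 1) := by
    have := Nat.lt_mul_div_succ (K - 1) hc0
    rw [← hqdef] at this
    omega
  have hfloor : ⌊((kOne k r - 1 : ℤ) : ℚ) / ((kOne k r - kTwo k r - 1 : ℤ) : ℚ)⌋ = (q : ℤ) := by
    have h1 : kOne k r - 1 = ((K - 1 : ℕ) : ℤ) := by rw [hkOne]; omega
    have h2 : kOne k r - kTwo k r - 1 = (c : ℤ) := by rw [hkTwo, hkOne]; linarith
    rw [h1, h2, Int.cast_natCast c, Rat.floor_intCast_div_natCast, hqdef, Int.natCast_div]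
  have hceil : ⌈((nOne n r - kOne k r + 1 : ℤ) : ℚ) / ((q : ℤ) : ℚ)⌉
      = (((N - K) / q + 1 : ℕ) : ℤ) := by
    have h1 : nOne n r - kOne k r + 1 = ((N - K + 1 : ℕ) : ℤ) := by rw [hnOne, hkOne]; omega
    rw [h1, Int.cast_natCast, Int.cast_natCast]
    exact ceil_natCast_succ_div _ hq0
  -- Since `n = N r + (n₁ - n₂)`, the inequality bounds from below the number `n₁ - n₂` of
  -- components that `N` checks on `r + 1` coordinates each form when their overlaps are tree-like.
  have hcond : nTwo n r ≤ nOne n r -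
        (⌈((nOne n r - kOne k r + 1 : ℤ) : ℚ) /
            (⌊((kOne k r - 1 : ℤ) : ℚ) / ((kOne k r - kTwo k r - 1 : ℤ) : ℚ)⌋ : ℚ)⌉
          + kOne k r - kTwo k r - 1) ↔ N * r + c + 1 + (N - K) / q ≤ n := by
    rw [hfloor, hceil, hnTwo, hnOne, hkTwo, hkOne]
    zify
    constructor <;> intro h' <;> linarith
  have hmax : (largestMinDist n k r : ℤ) = dStar n k r ↔
      n + 2 ≤ largestMinDist n k r + k + K := by
    have := singleton_bound hKn hK0 hK2 hgr.1
    rw [hdStar]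
    omega
  rw [hcond, hmax]
  constructor
  · intro hd
    exact add_div_le_of_mem_lrcMinDists hKn hc hN2 hKN hqK hgr.1 hd
  · intro hle
    -- `p = n₁ - n₂` is the number of classes used in the construction.
    have hlt := Nat.lt_mul_div_succ (N - K) hq0
    generalize (N - K) / q = t at hle hlt
    obtain ⟨e, he⟩ := Nat.exists_eq_add_of_le hle
    obtain ⟨p, hpdef⟩ : ∃ p, p = c + 1 + t + e := ⟨_, rfl⟩
    have hn : n = N * r + p := by omega
    have hpN : p ≤ N := by
      rw [mul_add, mul_one] at hN1
      omega
    have hp0 : 0 < p := by omega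
    have hNp : N < K + q * (p - c) := by
      have : q * (t + 1) ≤ q * (p - c) := Nat.mul_le_mul_left _ (by omega)
      omega
    obtain ⟨d, hd, hdn⟩ := exists_mem_lrcMinDists_ge hr (by omega)
      (lt_card_image_mod hp0 (by omega) hcq hqK hNp)
      (fun v => ⟨⟨v, by omega⟩, Fin.ext (Nat.mod_eq_of_lt v.2)⟩) hn hKn hc.le
    have := hgr.2 hd
    omega
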